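/- For a set $\Omega$ and a permutation group $H\le\mathrm{Sym}(\Omega)$, let $H^{(2),\Omega}$ (the $2$-closure of $H$) be the subgroup of all permutations of $\Omega$ which leave every orbit of $H$ on $\Omega\times\Omega$ fixed (setwise), where $H$ and $\mathrm{Sym}(\Omega)$ act diagonally on $\Omega\times\Omega$. A group $G$ is called totally $2$-closed if $H^{(2),\Omega}=H$ for every set $\Omega$ and every subgroup $H\le\mathrm{Sym}(\Omega)$ with $H\cong G$. A generalized quaternion group is a group of order $2^{k+2}$, for some $k\ge 1$, with presentation $\langle a,x\mid a^{2^{k+1}}=1,\ x^2=a^{2^k},\ x^{-1}ax=a^{-1}\rangle$ (for $k=1$ this is the quaternion group of order $8$). Theorem A. Let $G$ be a finite soluble group. Then $G$ is totally $2$-closed if and only if $G$ is cyclic or $G$ is isomorphic to the direct product of a (possibly trivial) cyclic group of odd order and a generalized quaternion group. In particular, every finite soluble totally $2$-closed group is nilpotent. -/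

import Mathlib

open scoped Pointwise

universe u v

/-- The `2`-closure of a permutation group `H ≤ Sym(Ω)`: the subgroup of all permutations of `Ω`
which, in the diagonal action on `Ω × Ω`, leave every orbit of `H` on `Ω × Ω` fixed (as a set). -/
def twoClosure {Ω : Type v} (H : Subgroup (Equiv.Perm Ω)) : Subgroup (Equiv.Perm Ω) :=
  ⨅ p : Ω × Ω, MulAction.stabilizer (Equiv.Perm Ω) (MulAction.orbit H p : Set (Ω × Ω))

/-- An abstract group `G` is totally `2`-closed if, for every set `Ω` (finite or infinite), every
subgroup `H` of `Sym(Ω)` isomorphic to `G` equals its `2`-closure. -/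
def IsTotallyTwoClosed (G : Type u) [Group G] : Prop :=
  ∀ (Ω : Type v) (H : Subgroup (Equiv.Perm Ω)), Nonempty (G ≃* H) → twoClosure H = H

/-!
A permutation lies in the `2`-closure of a permutation group exactly when it agrees, on every pair
of points, with some element of the group.

For a cyclic group, the elements agreeing with such a permutation at a given point form a coset of a
stabilizer, and these cosets meet pairwise. Since the subgroup lattice of a cyclic group is
distributive, they have a common element (`exists_smul_eq_of_isCyclic`). For `C × Q` with `C` cyclic
of odd order and `Q` generalized quaternion, faithfulness gives a point moved by the central
involution of `Q`. This involution lies in every nontrivial subgroup of `Q`, so the point has its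
stabilizer inside `C`. After multiplying by a group element the permutation fixes that point, hence
moves every point inside its `C`-orbit. Stabilizers split along the coprime factors, and the
statement for `C` applies.

Conversely, let `G` be totally `2`-closed. If `B` is normal and `A ⊓ B = ⊥`, then `G` acts
faithfully on the disjoint union of `G ⧸ A` and `G ⧸ B`. An element `a ∈ A` all of whose conjugates
lie in `A ⊔ B` gives a permutation in the `2`-closure: act as `a` on `G ⧸ A` and trivially on
`G ⧸ B`. That this permutation comes from `G` means that `a` lies in the normal core of `A`. A
similar action with three orbits rules out normal subgroups in diagonal position. These two
conditions are called rigidity here (`IsTotallyTwoClosed.isRigid`), and the rest of the argument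
uses nothing else.

* A soluble rigid group is nilpotent (`IsRigid.isNilpotent`). In a minimal non-nilpotent normal
  subgroup `E`, the first condition applies to a Sylow `r`-subgroup of `E` and the largest normal
  subgroup of `G` of order prime to `r`, and shows that the Sylow subgroup is normal.
* In a rigid `p`-group the abelian normal subgroups are cyclic (`IsRigid.isCyclic_of_normal`). Let
  `⟨a⟩` be a self-centralizing one, and let `x ∉ ⟨a⟩` with `x ^ p ∈ ⟨a⟩`. By the first condition a
  complement of `⟨a⟩` in `⟨a, x⟩` would be normal and so would centralize `⟨a⟩`, which is absurd.
  Computing `(a ^ i * x) ^ p` shows that this forces `p = 2` and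
  that `x` inverts `a` (`IsRigid.conj_eq_inv`). As inversion is not the square of an automorphism of
  `⟨a⟩`, the index of `⟨a⟩` is at most two, so the group is cyclic or generalized quaternion.
* Rigidity passes to direct factors, in particular to the Sylow subgroups of a nilpotent group, and
  a nilpotent group with cyclic Sylow subgroups is cyclic.
-/

open scoped Pointwise commutatorElement
open MulAction

universe w

/-! ### Permutation representations and the `2`-closure -/

theorem mem_twoClosure_iff {Ω : Type v} {H : Subgroup (Equiv.Perm Ω)} {σ : Equiv.Perm Ω} :
    σ ∈ twoClosure H ↔ ∀ a b : Ω, ∃ h ∈ H, σ a = h a ∧ σ b = h b := by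
  have key : ∀ p : Ω × Ω, σ • p ∈ orbit H p ↔ ∃ h ∈ H, σ p.1 = h p.1 ∧ σ p.2 = h p.2 := by
    rintro ⟨a, b⟩
    constructor
    · rintro ⟨h, hh⟩
      have h1 := congrArg Prod.fst hh
      have h2 := congrArg Prod.snd hh
      exact ⟨h, h.2, h1.symm, h2.symm⟩
    · rintro ⟨h, hh, h1, h2⟩
      exact ⟨⟨h, hh⟩, Prod.ext h1.symm h2.symm⟩
  simp only [twoClosure, Subgroup.mem_iInf, mem_stabilizer_iff]
  constructor
  · intro h a b
    refine (key (a, b)).1 ?_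
    rw [← h (a, b)]
    exact Set.smul_mem_smul_set (mem_orbit_self _)
  · intro h p
    have hall : ∀ q : Ω × Ω, σ • q ∈ orbit H q := fun q => (key q).2 (h q.1 q.2)
    ext q
    rw [Set.mem_smul_set_iff_inv_smul_mem]
    have hq := hall (σ⁻¹ • q)
    rw [smul_inv_smul] at hq
    rw [← orbit_eq_iff (a := σ⁻¹ • q), ← orbit_eq_iff (a := q), orbit_eq_iff.2 hq]

/-- `σ` agrees on every pair of points with some element of `G`; for a faithful action this says that
`σ` lies in the `2`-closure of the image of `G`. -/
def AgreesOnPairs (G : Type u) [Group G] {Ω : Type w} [MulAction G Ω] (σ : Equiv.Perm Ω) : Prop :=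
  ∀ a b : Ω, ∃ g : G, σ a = g • a ∧ σ b = g • b

theorem isTotallyTwoClosed_of_forall_agreesOnPairs {G : Type u} [Group G]
    (h : ∀ (Ω : Type v) [MulAction G Ω] [FaithfulSMul G Ω] (σ : Equiv.Perm Ω),
      AgreesOnPairs G σ → ∃ g : G, ∀ a : Ω, σ a = g • a) :
    IsTotallyTwoClosed.{u, v} G := by
  rintro Ω H ⟨e⟩
  let : MulAction G Ω := MulAction.compHom Ω (H.subtype.comp e.toMonoidHom)
  have hs : ∀ (g : G) (a : Ω), g • a = (e g : Equiv.Perm Ω) a := fun _ _ => rfl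
  have : FaithfulSMul G Ω := ⟨fun {g₁ g₂} hg =>
    e.injective (Subtype.ext (Equiv.ext fun a => by simpa only [hs] using hg a))⟩
  ext σ
  rw [mem_twoClosure_iff]
  constructor
  · intro hσ
    obtain ⟨g, hg⟩ := h Ω σ fun a b => by
      obtain ⟨k, hk, h1, h2⟩ := hσ a b
      exact ⟨e.symm ⟨k, hk⟩, by simp [hs, h1], by simp [hs, h2]⟩
    have : σ = e g := Equiv.ext hg
    rw [this]
    exact (e g).2
  · exact fun hσ a b => ⟨σ, hσ, rfl, rfl⟩

/-- The underlying set of a finite action may be moved to any universe, so total `2`-closedness in a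
fixed universe applies to finite faithful actions in every universe. -/
theorem IsTotallyTwoClosed.exists_smul_eq {G : Type u} [Group G]
    (hG : IsTotallyTwoClosed.{u, v} G) {Ω : Type w} [Finite Ω] [MulAction G Ω]
    (hf : ∀ g : G, (∀ a : Ω, g • a = a) → g = 1) {σ : Equiv.Perm Ω} (hσ : AgreesOnPairs G σ) :
    ∃ g : G, ∀ a : Ω, σ a = g • a := by
  obtain ⟨n, ⟨e₀⟩⟩ := Finite.exists_equiv_fin Ω
  let e : Ω ≃ ULift.{v} (Fin n) := e₀.trans Equiv.ulift.symm
  let f : G →* Equiv.Perm (ULift.{v} (Fin n)) :=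
    e.permCongrHom.toMonoidHom.comp (MulAction.toPermHom G Ω)
  have hfe : ∀ g x, f g x = e (g • e.symm x) := fun _ _ => rfl
  have hinj : Function.Injective f := by
    rw [injective_iff_map_eq_one]
    intro g hg
    refine hf g fun a => ?_
    have := hfe g (e a)
    rw [hg] at this
    simpa using this.symm
  have h := hG _ f.range ⟨f.ofInjective hinj⟩
  have hmem : e.permCongr σ ∈ f.range := by
    rw [← h, mem_twoClosure_iff]
    intro a b
    obtain ⟨g, h1, h2⟩ := hσ (e.symm a) (e.symm b)
    exact ⟨f g, ⟨g, rfl⟩, by simp [hfe, h1], by simp [hfe, h2]⟩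
  obtain ⟨g, hg⟩ := hmem
  refine ⟨g, fun a => ?_⟩
  have := hfe g (e a)
  rw [hg] at this
  simpa using this

theorem IsTotallyTwoClosed.congr {G : Type u} {G' : Type w} [Group G] [Group G'] (e : G ≃* G')
    (hG : IsTotallyTwoClosed.{u, v} G) : IsTotallyTwoClosed.{w, v} G' :=
  fun Ω H ⟨f⟩ => hG Ω H ⟨e.trans f⟩

/-! ### Cyclic groups -/

theorem Nat.gcd_lcm_dvd_lcm_gcd {a b : ℕ} (c : ℕ) :
    Nat.gcd (Nat.lcm a b) c ∣ Nat.lcm (Nat.gcd a c) (Nat.gcd b c) := by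
  rcases Nat.eq_zero_or_pos a with rfl | ha
  · simpa using Nat.dvd_lcm_left c (b.gcd c)
  rcases Nat.eq_zero_or_pos b with rfl | hb
  · simpa using Nat.dvd_lcm_right (a.gcd c) c
  rcases Nat.eq_zero_or_pos c with rfl | hc
  · simp
  have h1 : a.gcd c ≠ 0 := (Nat.gcd_pos_of_pos_left _ ha).ne'
  have h2 : b.gcd c ≠ 0 := (Nat.gcd_pos_of_pos_left _ hb).ne'
  refine Eq.dvd (Nat.eq_of_factorization_eq ?_ ?_ fun p => ?_)
  · exact (Nat.gcd_pos_of_pos_right _ hc).ne'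
  · exact Nat.lcm_ne_zero h1 h2
  · rw [Nat.factorization_gcd (Nat.lcm_ne_zero ha.ne' hb.ne') hc.ne',
      Nat.factorization_lcm ha.ne' hb.ne', Nat.factorization_lcm h1 h2,
      Nat.factorization_gcd ha.ne' hc.ne', Nat.factorization_gcd hb.ne' hc.ne']
    exact inf_sup_right (α := ℕ) _ _ _

/-- A finite system of congruences is solvable as soon as any two of them are: the arithmetic
progressions in `ℤ` have Helly number two, because the subgroup lattice of `ℤ` is distributive. -/
theorem exists_forall_dvd_sub_of_pairwise {ι : Type*} (s : Finset ι) (d : ι → ℕ) (a : ι → ℤ)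
    (h : ∀ i ∈ s, ∀ j ∈ s, ∃ x : ℤ, (d i : ℤ) ∣ x - a i ∧ (d j : ℤ) ∣ x - a j) :
    ∃ x : ℤ, ∀ i ∈ s, (d i : ℤ) ∣ x - a i := by
  classical
  induction s using Finset.induction_on with
  | empty => exact ⟨0, by simp⟩
  | insert k s hk ih =>
    obtain ⟨x, hx⟩ := ih fun i hi j hj =>
      h i (Finset.mem_insert_of_mem hi) j (Finset.mem_insert_of_mem hj)
    have hdist : ∀ t : Finset ι, Nat.gcd (t.lcm d) (d k) ∣ t.lcm fun i => Nat.gcd (d i) (d k) := by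
      intro t
      induction t using Finset.induction_on with
      | empty => simp
      | insert j t hj iht =>
        rw [Finset.lcm_insert, Finset.lcm_insert]
        exact (Nat.gcd_lcm_dvd_lcm_gcd _).trans (Nat.lcm_dvd (Nat.dvd_lcm_left _ _)
          (iht.trans (Nat.dvd_lcm_right _ _)))
    have hg : ((Nat.gcd (s.lcm d) (d k) : ℕ) : ℤ) ∣ a k - x := by
      rw [Int.natCast_dvd]
      refine (hdist s).trans (Finset.lcm_dvd fun i hi => ?_)
      rw [← Int.natCast_dvd]
      obtain ⟨y, h1, h2⟩ := h i (Finset.mem_insert_of_mem hi) k (Finset.mem_insert_self _ _)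
      have e1 : ((Nat.gcd (d i) (d k) : ℕ) : ℤ) ∣ (d i : ℤ) :=
        Int.natCast_dvd_natCast.2 (Nat.gcd_dvd_left _ _)
      have e2 : ((Nat.gcd (d i) (d k) : ℕ) : ℤ) ∣ (d k : ℤ) :=
        Int.natCast_dvd_natCast.2 (Nat.gcd_dvd_right _ _)
      have : a k - x = (y - a i) - (y - a k) - (x - a i) := by ring
      rw [this]
      exact ((e1.trans h1).sub (e2.trans h2)).sub (e1.trans (hx i hi))
    obtain ⟨c, hc⟩ := hg
    have hbez := Nat.gcd_eq_gcd_ab (s.lcm d) (d k)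
    refine ⟨x + (s.lcm d : ℕ) * Nat.gcdA (s.lcm d) (d k) * c, fun i hi => ?_⟩
    rcases Finset.mem_insert.1 hi with rfl | hi
    · refine ⟨-(Nat.gcdB (s.lcm d) (d i) * c), ?_⟩
      rw [hbez] at hc
      linear_combination -hc
    · have : ((d i : ℕ) : ℤ) ∣ ((s.lcm d : ℕ) : ℤ) := Int.natCast_dvd_natCast.2 (Finset.dvd_lcm hi)
      rw [add_sub_right_comm, mul_assoc]
      exact (hx i hi).add (this.mul_right _)

/-- A map agreeing on pairs of points with elements of a finite cyclic group agrees everywhere with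
one of them; the set `Ω` may be infinite and the action need not be faithful. -/
theorem exists_smul_eq_of_isCyclic {C : Type u} [Group C] [Finite C] [IsCyclic C] {Ω : Type w}
    [MulAction C Ω] {σ : Ω → Ω} (hσ : ∀ a b : Ω, ∃ c : C, σ a = c • a ∧ σ b = c • b) :
    ∃ c : C, ∀ a : Ω, σ a = c • a := by
  classical
  obtain ⟨g, hg⟩ := IsCyclic.exists_generator (α := C)
  have hdvd : ∀ (b : Ω) (i j : ℤ), g ^ i • b = g ^ j • b ↔
      ((Function.minimalPeriod (g • ·) b : ℕ) : ℤ) ∣ i - j := by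
    intro b i j
    rw [← MulAction.zpow_smul_eq_iff_minimalPeriod_dvd, sub_eq_neg_add, zpow_add, mul_smul, zpow_neg,
      inv_smul_eq_iff]
  have hex : ∀ a : Ω, ∃ i : ℤ, σ a = g ^ i • a := fun a => by
    obtain ⟨c, hc, -⟩ := hσ a a
    obtain ⟨i, rfl⟩ := hg c
    exact ⟨i, hc⟩
  choose r hr using hex
  by_contra! hcon
  choose bad hbad using hcon
  have := Fintype.ofFinite C
  -- `bad` takes finitely many values, and no element of `C` agrees with `σ` on all of them.
  obtain ⟨x, hx⟩ := exists_forall_dvd_sub_of_pairwise (Finset.univ.image bad)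
    (fun b => Function.minimalPeriod (g • ·) b) r fun a _ b _ => by
      obtain ⟨c, h1, h2⟩ := hσ a b
      obtain ⟨i, rfl⟩ := hg c
      exact ⟨i, (hdvd a i _).1 (h1.symm.trans (hr a)), (hdvd b i _).1 (h2.symm.trans (hr b))⟩
  refine hbad (g ^ x) ?_
  rw [hr, eq_comm, hdvd]
  exact hx _ (Finset.mem_image_of_mem _ (Finset.mem_univ _))

theorem isTotallyTwoClosed_of_isCyclic (G : Type u) [Group G] [Finite G] [IsCyclic G] :
    IsTotallyTwoClosed.{u, v} G :=
  isTotallyTwoClosed_of_forall_agreesOnPairs fun _ _ _ _ hσ => exists_smul_eq_of_isCyclic hσ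

/-! ### Products of an odd cyclic group and a generalized quaternion group -/

theorem QuaternionGroup.pow_four_mul (n : ℕ) [NeZero n] (q : QuaternionGroup n) :
    q ^ (4 * n) = 1 := by
  rw [← QuaternionGroup.card (n := n)]
  exact pow_card_eq_one

theorem QuaternionGroup.eq_a_of_sq_eq_one {n : ℕ} [NeZero n] {q : QuaternionGroup n} (h : q ^ 2 = 1)
    (hq : q ≠ 1) : q = QuaternionGroup.a n := by
  rcases q with i | i
  · rw [sq, QuaternionGroup.a_mul_a, QuaternionGroup.one_def, QuaternionGroup.a.injEq] at h
    rw [ne_eq, QuaternionGroup.one_def, QuaternionGroup.a.injEq] at hq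
    rw [QuaternionGroup.a.injEq]
    have hi : ((i.val : ℕ) : ZMod (2 * n)) = i := ZMod.natCast_zmod_val i
    rw [← hi, ← Nat.cast_add, ZMod.natCast_eq_zero_iff] at h
    have hlt := ZMod.val_lt i
    have h0 : i.val ≠ 0 := fun h0 => hq ((ZMod.val_eq_zero i).1 h0)
    obtain ⟨c, hc⟩ := h
    have : c = 1 := by
      have h1 : c < 2 := by
        by_contra! hc2
        have := Nat.mul_le_mul_left (2 * n) hc2
        omega
      have h2 : c ≠ 0 := by rintro rfl; omega
      omega
    subst this
    rw [← hi]
    congr 1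
    omega
  · have h4 := QuaternionGroup.orderOf_xa i
    have := orderOf_dvd_of_pow_eq_one h
    rw [h4] at this
    omega

/-- In a generalized quaternion group the central involution lies in every nontrivial subgroup. -/
theorem QuaternionGroup.exists_pow_eq_a {k : ℕ} {q : QuaternionGroup (2 ^ k)} (hq : q ≠ 1) :
    ∃ j : ℕ, q ^ j = QuaternionGroup.a ((2 ^ k : ℕ) : ZMod (2 * 2 ^ k)) := by
  classical
  have hex : ∃ j, q ^ 2 ^ j = 1 := ⟨k + 2, by
    rw [pow_add, mul_comm]; exact QuaternionGroup.pow_four_mul (2 ^ k) q⟩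
  obtain ⟨j, hj⟩ : ∃ j, Nat.find hex = j + 1 := by
    refine Nat.exists_eq_succ_of_ne_zero fun h => hq ?_
    simpa [h] using Nat.find_spec hex
  refine ⟨2 ^ j, QuaternionGroup.eq_a_of_sq_eq_one ?_ (Nat.find_min hex (by omega))⟩
  rw [← pow_mul, ← pow_succ, ← hj]
  exact Nat.find_spec hex

theorem isTotallyTwoClosed_zmod_prod_quaternionGroup {m k : ℕ} (hm : Odd m) :
    IsTotallyTwoClosed.{0, v} (Multiplicative (ZMod m) × QuaternionGroup (2 ^ k)) := by
  have : NeZero m := ⟨by rintro rfl; exact absurd hm (by decide)⟩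
  refine isTotallyTwoClosed_of_forall_agreesOnPairs fun Ω _ _ σ hσ => ?_
  let C := Multiplicative (ZMod m)
  let Q := QuaternionGroup (2 ^ k)
  have hCm : ∀ c : C, c ^ m = 1 := fun c => by
    have := pow_card_eq_one' (G := C) (x := c)
    rwa [Nat.card_eq_fintype_card, Fintype.card_multiplicative, ZMod.card] at this
  have hcop : Nat.Coprime (4 * 2 ^ k) m := by
    rw [show 4 * 2 ^ k = 2 ^ (k + 2) by ring]
    exact Nat.Coprime.pow_left _ (Nat.coprime_two_left.2 hm)
  -- Raising to the power `e` projects onto the cyclic factor, so stabilizers split.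
  obtain ⟨e, he0, he1⟩ := Nat.chineseRemainder hcop 0 1
  have heC : ∀ c : C, c ^ e = c := fun c => by
    conv_rhs => rw [← pow_one c]
    exact pow_eq_pow_iff_modEq.2 (he1.of_dvd (orderOf_dvd_of_pow_eq_one (hCm c)))
  have heQ : ∀ q : Q, q ^ e = 1 := fun q => by
    obtain ⟨r, hr⟩ := (Nat.modEq_zero_iff_dvd).1 he0
    rw [hr, pow_mul, QuaternionGroup.pow_four_mul, one_pow]
  have hstabC : ∀ (g : C × Q) (b : Ω), g • b = b → ((g.1, 1) : C × Q) • b = b := by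
    intro g b hg
    have : g ^ e = (g.1, 1) := Prod.ext (heC g.1) (heQ g.2)
    rw [← this]
    exact pow_mem (S := MulAction.stabilizer (C × Q) b) hg e
  have hstabQ : ∀ (g : C × Q) (b : Ω), g • b = b → ((1, g.2) : C × Q) • b = b := by
    intro g b hg
    have h1 := hstabC g b hg
    calc ((1, g.2) : C × Q) • b = ((g.1, 1) : C × Q)⁻¹ • g • b := by
          rw [smul_smul]
          congr 1
          exact Prod.ext (inv_mul_cancel g.1).symm (by simp)
      _ = b := by rw [hg, inv_smul_eq_iff, h1]
  let z : C × Q := (1, QuaternionGroup.a ((2 ^ k : ℕ) : ZMod (2 * 2 ^ k)))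
  -- A point not fixed by the central involution has its stabilizer inside the cyclic factor.
  obtain ⟨α, hα⟩ : ∃ α : Ω, z • α ≠ α := by
    by_contra! hz
    have h1 : z = 1 := FaithfulSMul.eq_of_smul_eq_smul fun a : Ω => by rw [hz, one_smul]
    have h2 := congrArg Prod.snd h1
    rw [Prod.snd_one, QuaternionGroup.one_def, QuaternionGroup.a.injEq,
      ZMod.natCast_eq_zero_iff] at h2
    have := Nat.le_of_dvd (by positivity) h2
    have := Nat.two_pow_pos k
    omega
  have hαstab : ∀ g : C × Q, g • α = α → g.2 = 1 := by
    intro g hg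
    by_contra hq
    obtain ⟨j, hj⟩ := QuaternionGroup.exists_pow_eq_a hq
    refine hα ?_
    have : z = ((1, g.2) : C × Q) ^ j := Prod.ext (by simp [z]) (by simp [z, hj])
    rw [this]
    exact pow_mem (S := MulAction.stabilizer (C × Q) α) (hstabQ g α hg) j
  -- Replace `σ` by `g₀⁻¹ σ`, which fixes `α`.
  obtain ⟨g₀, hg₀, -⟩ := hσ α α
  let : MulAction C Ω := MulAction.compHom Ω (MonoidHom.inl C Q)
  have hCs : ∀ (c : C) (b : Ω), c • b = ((c, 1) : C × Q) • b := fun _ _ => rfl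
  have hσ' : ∀ a b : Ω, ∃ g : C × Q, g₀⁻¹ • σ a = g • a ∧ g₀⁻¹ • σ b = g • b := fun a b => by
    obtain ⟨g, h1, h2⟩ := hσ a b
    exact ⟨g₀⁻¹ * g, by rw [h1, mul_smul], by rw [h2, mul_smul]⟩
  have hpt : ∀ b : Ω, ∃ c : C, g₀⁻¹ • σ b = c • b := fun b => by
    obtain ⟨g, h1, h2⟩ := hσ' α b
    rw [hg₀, inv_smul_smul] at h1
    refine ⟨g.1, ?_⟩
    rw [h2, hCs]
    congr 1
    exact Prod.ext rfl (hαstab g h1.symm)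
  have hmove : ∀ (g : C × Q) (b : Ω), g₀⁻¹ • σ b = g • b → g₀⁻¹ • σ b = g.1 • b := by
    intro g b hg
    obtain ⟨c, hc⟩ := hpt b
    have h1 : ((c, 1)⁻¹ * g) • b = b := by
      rw [mul_smul, ← hg, hc, hCs, inv_smul_smul]
    have h2 := hstabC _ b h1
    rw [hc, hCs, hCs]
    calc ((c, 1) : C × Q) • b = ((c, 1) : C × Q) • ((((c, 1)⁻¹ * g).1, 1) : C × Q) • b := by rw [h2]
      _ = ((g.1, 1) : C × Q) • b := by
          rw [smul_smul]
          congr 1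
          exact Prod.ext (mul_inv_cancel_left c g.1) (mul_one 1)
  obtain ⟨c, hc⟩ := exists_smul_eq_of_isCyclic (C := C) (σ := fun b => g₀⁻¹ • σ b) fun a b => by
    obtain ⟨g, h1, h2⟩ := hσ' a b
    exact ⟨g.1, hmove g a h1, hmove g b h2⟩
  refine ⟨g₀ * (c, 1), fun a => ?_⟩
  rw [mul_smul, ← hCs, ← hc a, smul_inv_smul]

/-! ### Two conditions satisfied by totally `2`-closed groups -/

/-- The permutation of `X ⊕ Y` acting as `a` on `X` and trivially on `Y` comes from `G` once it does
so on each pair consisting of a point of `X` and a point of `Y`. -/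
theorem IsTotallyTwoClosed.exists_smul_eq_left {G : Type u} [Group G]
    (hG : IsTotallyTwoClosed.{u, v} G) {X Y : Type*} [Finite X] [Finite Y] [MulAction G X]
    [MulAction G Y] (hf : ∀ g : G, (∀ x : X, g • x = x) → (∀ y : Y, g • y = y) → g = 1) (a : G)
    (h : ∀ (x : X) (y : Y), ∃ g : G, g • x = a • x ∧ g • y = y) :
    ∃ g : G, (∀ x : X, g • x = a • x) ∧ ∀ y : Y, g • y = y := by
  obtain ⟨g, hg⟩ := hG.exists_smul_eq (Ω := X ⊕ Y)
    (σ := Equiv.sumCongr (MulAction.toPerm a) (Equiv.refl Y))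
    (fun g hg => hf g (fun x => Sum.inl_injective (hg (Sum.inl x)))
      fun y => Sum.inr_injective (hg (Sum.inr y))) (by
      rintro (x | y) (x' | y')
      · exact ⟨a, by simp, by simp⟩
      · obtain ⟨g, h1, h2⟩ := h x y'
        exact ⟨g, by simp [h1], by simp [h2]⟩
      · obtain ⟨g, h1, h2⟩ := h x' y
        exact ⟨g, by simp [h2], by simp [h1]⟩
      · exact ⟨1, by simp, by simp⟩)
  exact ⟨g, fun x => (Sum.inl_injective (hg (Sum.inl x))).symm,
    fun y => (Sum.inr_injective (hg (Sum.inr y))).symm⟩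

/-- The two consequences of total `2`-closedness on which the classification rests. They come from
intransitive actions with two and with three orbits, and both pass to direct factors. -/
structure IsRigid (G : Type u) [Group G] : Prop where
  /-- A subgroup `A` meeting a normal subgroup `B` trivially is normal, provided that some normal
  subgroup lies between `A` and `A ⊔ B`. -/
  normal_of_le_sup : ∀ A B N : Subgroup G, B.Normal → N.Normal → A ⊓ B = ⊥ → A ≤ N → N ≤ A ⊔ B →
    A.Normal
  /-- There are no three normal subgroups in diagonal position. -/
  le_of_le_sup : ∀ A B C : Subgroup G, A.Normal → B.Normal → C.Normal → B ⊓ C = ⊥ → C ≤ A ⊔ B →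
    C ≤ A

theorem Subgroup.mem_of_forall_smul_quotient_eq {G : Type u} [Group G] {A : Subgroup G} {g : G}
    (h : ∀ x : G ⧸ A, g • x = x) : g ∈ A := by
  have := h ((1 : G) : G ⧸ A)
  rw [MulAction.Quotient.smul_coe, eq_comm, QuotientGroup.eq] at this
  simpa using this

theorem Subgroup.smul_quotient_eq_of_mem {G : Type u} [Group G] {A : Subgroup G} [A.Normal] {g : G}
    (hg : g ∈ A) (x : G ⧸ A) : g • x = x := by
  induction x using QuotientGroup.induction_on with
  | H u =>
    rw [MulAction.Quotient.smul_coe, eq_comm, QuotientGroup.eq, smul_eq_mul, ← mul_assoc]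
    simpa using Subgroup.Normal.conj_mem ‹A.Normal› g hg u⁻¹

theorem IsTotallyTwoClosed.isRigid {G : Type u} [Group G] [Finite G]
    (hG : IsTotallyTwoClosed.{u, v} G) : IsRigid G where
  normal_of_le_sup A B N hB hN hAB hAN hNAB := by
    have hbot : ∀ g, g ∈ A → g ∈ B → g = 1 := fun g h1 h2 => by
      have : g ∈ A ⊓ B := ⟨h1, h2⟩
      rwa [hAB, Subgroup.mem_bot] at this
    refine ⟨fun a ha u => ?_⟩
    -- Move the cosets of `A` by `a` and fix those of `B`.
    obtain ⟨g, h1, h2⟩ := hG.exists_smul_eq_left (X := G ⧸ A) (Y := G ⧸ B)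
      (fun g h1 h2 => hbot g (Subgroup.mem_of_forall_smul_quotient_eq h1)
        (Subgroup.mem_of_forall_smul_quotient_eq h2)) a fun x y => by
        induction x using QuotientGroup.induction_on with
        | H u =>
          have hu := hNAB (hN.conj_mem a (hAN ha) u⁻¹)
          rw [sup_comm, Subgroup.mem_sup_of_normal_left] at hu
          obtain ⟨b, hb, a', ha', he⟩ := hu
          refine ⟨u * b * u⁻¹, ?_, Subgroup.smul_quotient_eq_of_mem (hB.conj_mem b hb u) y⟩
          rw [MulAction.Quotient.smul_coe, MulAction.Quotient.smul_coe, QuotientGroup.eq]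
          have : (u * b * u⁻¹ * u)⁻¹ * (a * u) = a' := by
            rw [← mul_right_inj b, he]; group
          rwa [smul_eq_mul, smul_eq_mul, this]
    have hgB := Subgroup.mem_of_forall_smul_quotient_eq h2
    have hgA : g ∈ A := by
      have := h1 ((1 : G) : G ⧸ A)
      rw [MulAction.Quotient.smul_coe, MulAction.Quotient.smul_coe, QuotientGroup.eq] at this
      simpa [Subgroup.mul_mem_cancel_right _ ha] using this
    have h3 := h1 ((u⁻¹ : G) : G ⧸ A)
    rw [hbot g hgA hgB, one_smul, MulAction.Quotient.smul_coe, QuotientGroup.eq] at h3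
    simpa [mul_assoc] using h3
  le_of_le_sup A B C hA hB hC hBC hCAB := by
    have hbot : ∀ g, g ∈ B → g ∈ C → g = 1 := fun g h1 h2 => by
      have : g ∈ B ⊓ C := ⟨h1, h2⟩
      rwa [hBC, Subgroup.mem_bot] at this
    have hmem : ∀ g : G, (∀ y : (G ⧸ B) ⊕ (G ⧸ C), g • y = y) → g = 1 := fun g h =>
      hbot g (Subgroup.mem_of_forall_smul_quotient_eq fun x => Sum.inl_injective (h (Sum.inl x)))
        (Subgroup.mem_of_forall_smul_quotient_eq fun x => Sum.inr_injective (h (Sum.inr x)))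
    intro c hc
    -- Move the cosets of `A` by `c` and fix those of `B` and `C`.
    obtain ⟨g, h1, h2⟩ := hG.exists_smul_eq_left (X := G ⧸ A) (Y := (G ⧸ B) ⊕ (G ⧸ C))
      (fun g _ h2 => hmem g h2) c fun x y => by
        rcases y with y | y
        · have hc' := hCAB hc
          rw [sup_comm, Subgroup.mem_sup_of_normal_left] at hc'
          obtain ⟨b, hb, a, ha, rfl⟩ := hc'
          exact ⟨b, by rw [mul_smul, Subgroup.smul_quotient_eq_of_mem ha],
            by rw [Sum.smul_inl, Subgroup.smul_quotient_eq_of_mem hb]⟩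
        · exact ⟨c, rfl, by rw [Sum.smul_inr, Subgroup.smul_quotient_eq_of_mem hc]⟩
    rw [hmem g h2] at h1
    exact Subgroup.mem_of_forall_smul_quotient_eq fun x => by rw [← h1 x, one_smul]

/-- Rigidity passes to a direct factor, here given by an embedding whose image is normalized by `G`
only through inner automorphisms of the factor. -/
theorem IsRigid.of_injective {G : Type u} {P : Type w} [Group G] [Group P] (hG : IsRigid G)
    (f : P →* G) (hf : Function.Injective f)
    (hconj : ∀ g : G, ∃ y : P, ∀ x : P, g * f x * g⁻¹ = f (y * x * y⁻¹)) : IsRigid P := by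
  have hmap : ∀ N : Subgroup P, N.Normal → (N.map f).Normal := fun N hN => ⟨by
    rintro _ ⟨x, hx, rfl⟩ g
    obtain ⟨y, hy⟩ := hconj g
    exact ⟨_, hN.conj_mem x hx y, (hy x).symm⟩⟩
  constructor
  · intro A B N hB hN hAB hAN hNAB
    have h := hG.normal_of_le_sup (A.map f) (B.map f) (N.map f) (hmap B hB) (hmap N hN)
      (by rw [← Subgroup.map_inf _ _ _ hf, hAB, Subgroup.map_bot]) (Subgroup.map_mono hAN)
      (by rw [← Subgroup.map_sup]; exact Subgroup.map_mono hNAB)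
    rw [← Subgroup.comap_map_eq_self_of_injective hf A]
    exact h.comap f
  · intro A B C hA hB hC hBC hCAB
    have h := hG.le_of_le_sup (A.map f) (B.map f) (C.map f) (hmap A hA) (hmap B hB) (hmap C hC)
      (by rw [← Subgroup.map_inf _ _ _ hf, hBC, Subgroup.map_bot])
      (by rw [← Subgroup.map_sup]; exact Subgroup.map_mono hCAB)
    exact (Subgroup.map_le_map_iff_of_injective hf).1 h

theorem IsRigid.fst {P K : Type*} [Group P] [Group K] (h : IsRigid (P × K)) : IsRigid P :=
  h.of_injective (MonoidHom.inl P K) (fun _ _ h => congrArg Prod.fst h) fun g =>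
    ⟨g.1, fun x => Prod.ext rfl (by simp)⟩

theorem IsRigid.congr {G G' : Type*} [Group G] [Group G'] (h : IsRigid G) (e : G ≃* G') :
    IsRigid G' :=
  h.of_injective e.symm.toMonoidHom e.symm.injective fun g => ⟨e g, fun x => by simp⟩

/-! ### Soluble rigid groups are nilpotent -/

/-- The largest normal subgroup of order prime to `p` exists. -/
theorem exists_greatest_normal_coprime (G : Type u) [Group G] [Finite G] (p : ℕ) :
    ∃ B : Subgroup G, B.Normal ∧ (Nat.card B).Coprime p ∧
      ∀ M : Subgroup G, M.Normal → (Nat.card M).Coprime p → M ≤ B := by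
  obtain ⟨B, ⟨hB, hBp⟩, hmax⟩ := Set.Finite.exists_maximal
    (Set.toFinite {B : Subgroup G | B.Normal ∧ (Nat.card B).Coprime p})
    ⟨⊥, Subgroup.normal_bot, by simp⟩
  refine ⟨B, hB, hBp, fun M hM hMp => ?_⟩
  refine le_sup_left.trans (hmax (y := M ⊔ B) ⟨Subgroup.sup_normal M B, ?_⟩ le_sup_right)
  have h1 := Subgroup.card_mul_index (B.subgroupOf (M ⊔ B))
  rw [← Subgroup.relIndex, Subgroup.relIndex_sup_right,
    Nat.card_congr (Subgroup.subgroupOfEquivOfLe le_sup_right).toEquiv] at h1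
  change (Nat.card ↥(M ⊔ B)).Coprime p
  rw [← h1]
  exact Nat.Coprime.mul_left hBp (hMp.coprime_dvd_left (Subgroup.relIndex_dvd_card _ _))

theorem Subgroup.le_of_forall_sylow_le {G : Type u} [Group G] [Finite G] {N X : Subgroup G}
    (h : ∀ (p : ℕ) [Fact p.Prime] (P : Sylow p N), (P : Subgroup N).map N.subtype ≤ X) :
    N ≤ X := by
  rw [← Subgroup.subgroupOf_eq_top, ← Subgroup.index_eq_one]
  by_contra hne
  obtain ⟨p, hp, hdvd⟩ := Nat.exists_prime_and_dvd hne
  have : Fact p.Prime := ⟨hp⟩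
  let P : Sylow p N := default
  refine P.not_dvd_index (hdvd.trans (Subgroup.index_dvd_of_le ?_))
  exact Subgroup.map_le_iff_le_comap.1 (h p P)

theorem Sylow.normal_map_subtype_of_isNilpotent {G : Type u} [Group G] [Finite G] {N : Subgroup G}
    [N.Normal] [Group.IsNilpotent N] {p : ℕ} [Fact p.Prime] (P : Sylow p N) :
    ((P : Subgroup N).map N.subtype).Normal := by
  have := P.characteristic_of_normal inferInstance
  exact ConjAct.normal_of_characteristic_of_normal

theorem Sylow.coprime_card_map {G H : Type*} [Group G] [Group H] [Finite G] {p r : ℕ}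
    [Fact p.Prime] [Fact r.Prime] (hpr : p ≠ r) (P : Sylow p G) (f : G →* H) :
    (Nat.card ((P : Subgroup G).map f)).Coprime r := by
  have : Finite ((P : Subgroup G).map f) := Finite.Set.finite_image _ f
  obtain ⟨n, hn⟩ := IsPGroup.iff_card.1 (P.isPGroup'.map f)
  rw [hn]
  exact Nat.Coprime.pow_left _ ((Nat.coprime_primes Fact.out Fact.out).2 hpr)

/-- A Frattini argument: modulo the commutator subgroup of a normal subgroup `E`, a Sylow subgroup of
`E` is normal in the whole group. -/
theorem Sylow.normal_map_subtype_sup_commutator {G : Type u} [Group G] [Finite G] {E : Subgroup G}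
    [E.Normal] {r : ℕ} [Fact r.Prime] (P : Sylow r E) :
    ((P : Subgroup E).map E.subtype ⊔ ⁅E, E⁆).Normal := by
  refine ⟨fun x hx g => ?_⟩
  obtain ⟨_, ⟨a, ha, rfl⟩, d, hd, rfl⟩ := Subgroup.mem_sup_of_normal_right.1 hx
  obtain ⟨e, he⟩ := MulAction.exists_smul_eq E P ((MulAut.conjNormal g : MulAut E) • P)
  have hmem : (MulAut.conjNormal g : MulAut E) • a ∈
      ((MulAut.conjNormal g : MulAut E) • P : Sylow r E) :=
    Subgroup.smul_mem_pointwise_smul a _ _ ha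
  rw [← he] at hmem
  obtain ⟨a', ha', h2⟩ : ∃ a' ∈ (P : Subgroup E), MulAut.conj e • a' = MulAut.conjNormal g • a :=
    (Subgroup.mem_smul_pointwise_iff_exists _ _ _).1 hmem
  have h3 : g * a * g⁻¹ = ⁅(e : G), (a' : G)⁆ * a' := by
    have := congrArg (Subtype.val) h2
    simp only [MulAut.smul_def, MulAut.conj_apply, MulAut.conjNormal_apply, Subgroup.coe_mul,
      Subgroup.coe_inv] at this
    rw [← this, commutatorElement_def]
    group
  have h4 : g * (E.subtype a * d) * g⁻¹ = ⁅(e : G), (a' : G)⁆ * a' * (g * d * g⁻¹) := by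
    rw [← h3, Subgroup.coe_subtype]; group
  rw [h4]
  have hE : (⁅E, E⁆ : Subgroup G).Normal := inferInstance
  exact mul_mem (mul_mem
    (Subgroup.mem_sup_right (Subgroup.commutator_mem_commutator e.2 a'.2))
    (Subgroup.mem_sup_left ⟨a', ha', rfl⟩)) (Subgroup.mem_sup_right (hE.conj_mem d hd g))

/-- In a minimal non-nilpotent normal subgroup `E`, a Sylow `r`-subgroup has the largest normal
subgroup of `G` of order prime to `r` as a complement in a subgroup containing `⁅E, E⁆`; rigidity
then makes it normal. -/
theorem IsRigid.isNilpotent {G : Type u} [Group G] [Finite G] [Group.IsSolvable G]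
    (hG : IsRigid G) : Group.IsNilpotent G := by
  by_contra hnil
  obtain ⟨E, ⟨hE, hEnil⟩, hmin⟩ := Set.Finite.exists_minimal
    (Set.toFinite {E : Subgroup G | E.Normal ∧ ¬ Group.IsNilpotent E})
    ⟨⊤, Subgroup.normal_top, fun h => hnil (Group.nilpotent_of_mulEquiv Subgroup.topEquiv)⟩
  have hEbot : E ≠ ⊥ := by
    rintro rfl
    exact hEnil inferInstance
  have hD := Group.IsSolvable.commutator_lt_of_ne_bot hEbot
  have hDnil : Group.IsNilpotent (⁅E, E⁆ : Subgroup G) := by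
    by_contra h
    exact hD.not_ge (hmin ⟨inferInstance, h⟩ hD.le)
  refine hEnil (((Group.isNilpotent_of_finite_tfae (G := E)).out 3 0).1 fun r hr P => ?_)
  have := hr
  obtain ⟨B, hB, hBr, hBmax⟩ := exists_greatest_normal_coprime G r
  have hdisj : (P : Subgroup E).map E.subtype ⊓ B = ⊥ := by
    refine disjoint_iff.1 (Subgroup.disjoint_of_coprime_natCard ?_)
    obtain ⟨n, hn⟩ := IsPGroup.iff_card.1 (P.isPGroup'.map E.subtype)
    rw [hn]
    exact Nat.Coprime.pow_left _ hBr.symm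
  have hDle : (⁅E, E⁆ : Subgroup G) ≤ (P : Subgroup E).map E.subtype ⊔ B := by
    refine Subgroup.le_of_forall_sylow_le fun p _ Q => ?_
    have hQ := Q.normal_map_subtype_of_isNilpotent
    by_cases hpr : p = r
    · subst hpr
      refine le_trans ?_ le_sup_left
      have hQE : (Q : Subgroup _).map (⁅E, E⁆ : Subgroup G).subtype ≤ E :=
        (Subgroup.map_subtype_le _).trans hD.le
      have h1 : IsPGroup p (((Q : Subgroup _).map (⁅E, E⁆ : Subgroup G).subtype).subgroupOf E) :=
        (Q.isPGroup'.map _).comap_subtype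
      have h2 := Subgroup.map_mono (f := E.subtype) (h1.le_sylow_of_normal P)
      rwa [Subgroup.subgroupOf_map_subtype, inf_eq_left.2 hQE] at h2
    · exact (hBmax _ hQ (Q.coprime_card_map hpr _)).trans le_sup_right
  have hA := hG.normal_of_le_sup _ B _ hB P.normal_map_subtype_sup_commutator hdisj le_sup_left
    (sup_le le_sup_left hDle)
  rw [← Subgroup.comap_map_eq_self_of_injective E.subtype_injective (P : Subgroup E)]
  exact hA.comap _

/-- A finite nilpotent group is the direct product of a Sylow subgroup and a normal complement. -/
theorem Sylow.exists_mulEquiv_prod {G : Type u} [Group G] [Finite G] [Group.IsNilpotent G] {p : ℕ}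
    [Fact p.Prime] (P : Sylow p G) :
    ∃ K : Subgroup G, (Nat.card K).Coprime p ∧ Nonempty (G ≃* P × K) := by
  obtain ⟨K, hK, hKp, hKmax⟩ := exists_greatest_normal_coprime G p
  refine ⟨K, hKp, ?_⟩
  have hdisj : Disjoint (P : Subgroup G) K := by
    refine Subgroup.disjoint_of_coprime_natCard ?_
    obtain ⟨n, hn⟩ := IsPGroup.iff_card.1 P.isPGroup'
    rw [hn]
    exact Nat.Coprime.pow_left _ hKp.symm
  have hsup : (P : Subgroup G) ⊔ K = ⊤ := by
    rw [eq_top_iff]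
    refine Subgroup.le_of_forall_sylow_le fun q _ Q => ?_
    have : Group.IsNilpotent (⊤ : Subgroup G) := Group.isNilpotent_top.2 inferInstance
    have hQ := Q.normal_map_subtype_of_isNilpotent
    by_cases hqp : q = p
    · subst hqp
      exact ((Q.isPGroup'.map _).le_sylow_of_normal P).trans le_sup_left
    · exact (hKmax _ hQ (Q.coprime_card_map hqp _)).trans le_sup_right
  have hcomm : ∀ (x : P) (y : K), Commute ((P : Subgroup G).subtype x) (K.subtype y) := fun x y =>
    Subgroup.commute_of_normal_of_disjoint _ _ inferInstance hK hdisj _ _ x.2 y.2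
  let f := MonoidHom.noncommCoprod _ _ hcomm
  refine ⟨(MulEquiv.ofBijective f ⟨?_, ?_⟩).symm⟩
  · rw [MonoidHom.noncommCoprod_injective]
    refine ⟨Subgroup.subtype_injective _, Subgroup.subtype_injective _, ?_⟩
    rwa [Subgroup.range_subtype, Subgroup.range_subtype]
  · rw [← MonoidHom.range_eq_top, MonoidHom.noncommCoprod_range]
    rwa [Subgroup.range_subtype, Subgroup.range_subtype]

/-! ### Rigid groups of prime power order -/

theorem Subgroup.inf_eq_bot_of_prime_card {G : Type u} [Group G] {p : ℕ} (hp : p.Prime)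
    {A B : Subgroup G} (hA : Nat.card A = p) (hAB : ¬ A ≤ B) : A ⊓ B = ⊥ := by
  have : Finite A := Nat.finite_of_card_ne_zero (hA ▸ hp.ne_zero)
  have h1 : Nat.card (A ⊓ B : Subgroup G) ∣ p := hA ▸ Subgroup.card_dvd_of_le inf_le_left
  rcases (Nat.dvd_prime hp).1 h1 with h | h
  · exact Subgroup.card_eq_one.1 h
  · exact absurd (inf_eq_left.1 (Subgroup.eq_of_le_of_card_ge inf_le_left (by rw [h, hA]))) hAB

theorem mem_zpowers_symm_of_orderOf_eq_prime {G : Type u} [Group G] {p : ℕ} (hp : p.Prime) {x y : G}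
    (hx : orderOf x = p) (hy : orderOf y = p) (h : x ∈ Subgroup.zpowers y) :
    y ∈ Subgroup.zpowers x := by
  have : Finite (Subgroup.zpowers y) :=
    Nat.finite_of_card_ne_zero (by rw [Nat.card_zpowers, hy]; exact hp.ne_zero)
  rw [Subgroup.eq_of_le_of_card_ge (Subgroup.zpowers_le.2 h)
    (by rw [Nat.card_zpowers, Nat.card_zpowers, hx, hy])]
  exact Subgroup.mem_zpowers y

theorem Subgroup.normal_zpowers_of_mem_center {G : Type u} [Group G] {z : G}
    (hz : z ∈ Subgroup.center G) : (Subgroup.zpowers z).Normal := by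
  refine ⟨fun y hy g => ?_⟩
  have := Subgroup.mem_center_iff.1 (Subgroup.zpowers_le.2 hz hy) g
  rwa [this, mul_inv_cancel_right]

theorem Subgroup.normal_zpowers_sup {G : Type u} [Group G] {C : Subgroup G} (hC : C.Normal) {x : G}
    (hx : ∀ g, ⁅x, g⁆ ∈ C) : (Subgroup.zpowers x ⊔ C).Normal := by
  refine ⟨fun y hy g => ?_⟩
  suffices h : Subgroup.zpowers x ⊔ C ≤
      (Subgroup.zpowers x ⊔ C).comap (MulAut.conj g).toMonoidHom from h hy
  refine sup_le (Subgroup.zpowers_le.2 ?_) fun c hc => Subgroup.mem_sup_right (hC.conj_mem c hc g)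
  change g * x * g⁻¹ ∈ Subgroup.zpowers x ⊔ C
  have : g * x * g⁻¹ = ⁅x, g⁆⁻¹ * x := by rw [commutatorElement_def]; group
  rw [this]
  exact mul_mem (Subgroup.mem_sup_right (inv_mem (hx g)))
    (Subgroup.mem_sup_left (Subgroup.mem_zpowers x))

/-- In a nilpotent group a normal subgroup `V` not contained in `X` contains an element outside `X`
which is central modulo `X`. -/
theorem Subgroup.exists_mem_forall_commutator_mem {G : Type u} [Group G] [Group.IsNilpotent G]
    {V X : Subgroup G} (hV : V.Normal) (h : ¬ V ≤ X) : ∃ x ∈ V, x ∉ X ∧ ∀ g, ⁅x, g⁆ ∈ X := by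
  classical
  have hex : ∃ n, ¬ V ⊓ Subgroup.upperCentralSeries G n ≤ X := by
    obtain ⟨n, hn⟩ := Group.IsNilpotent.nilpotent G
    exact ⟨n, by rwa [hn, inf_top_eq]⟩
  obtain ⟨n, hn⟩ : ∃ n, Nat.find hex = n + 1 := by
    refine Nat.exists_eq_succ_of_ne_zero fun h0 => ?_
    have := Nat.find_spec hex
    rw [h0, Subgroup.upperCentralSeries_zero, inf_bot_eq] at this
    exact this bot_le
  have h1 := Nat.find_spec hex
  have h2 := Nat.find_min hex (m := n) (by omega)
  rw [hn] at h1
  rw [not_not] at h2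
  obtain ⟨x, ⟨hxV, hxZ⟩, hxX⟩ := Set.not_subset.1 h1
  refine ⟨x, hxV, hxX, fun g => h2 ⟨?_, Subgroup.mem_upperCentralSeries_succ_iff.1 hxZ g⟩⟩
  have : ⁅x, g⁆ = x * (g * x⁻¹ * g⁻¹) := by rw [commutatorElement_def]; group
  rw [SetLike.mem_coe, this]
  exact mul_mem hxV (hV.conj_mem _ (inv_mem hxV) g)

/-- A rigid group has no normal subgroup `C_p × C_p` meeting the center: the second generator would
first be central by the splitting condition and then violate the condition on triples. -/
theorem IsRigid.mem_zpowers {G : Type u} [Group G] (hG : IsRigid G) {p : ℕ} (hp : p.Prime) {x z : G}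
    (hx : orderOf x = p) (hz : orderOf z = p) (hzc : z ∈ Subgroup.center G)
    (hxz : ∀ g, ⁅x, g⁆ ∈ Subgroup.zpowers z) : x ∈ Subgroup.zpowers z := by
  by_contra hcon
  have hB := Subgroup.normal_zpowers_of_mem_center hzc
  have hdisj : Subgroup.zpowers x ⊓ Subgroup.zpowers z = ⊥ :=
    Subgroup.inf_eq_bot_of_prime_card hp (by rw [Nat.card_zpowers, hx])
      fun h => hcon (h (Subgroup.mem_zpowers x))
  have hA := hG.normal_of_le_sup _ _ _ hB (Subgroup.normal_zpowers_sup hB hxz) hdisj le_sup_left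
    le_rfl
  have hxc : x ∈ Subgroup.center G := by
    rw [Subgroup.mem_center_iff]
    intro g
    have h1 : ⁅x, g⁆ ∈ Subgroup.zpowers x ⊓ Subgroup.zpowers z := by
      refine ⟨?_, hxz g⟩
      have : ⁅x, g⁆ = x * (g * x⁻¹ * g⁻¹) := by rw [commutatorElement_def]; group
      rw [SetLike.mem_coe, this]
      exact mul_mem (Subgroup.mem_zpowers x)
        (hA.conj_mem _ (inv_mem (Subgroup.mem_zpowers x)) g)
    rw [hdisj, Subgroup.mem_bot, commutatorElement_eq_one_iff_mul_comm] at h1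
    exact h1.symm
  have hxzp : orderOf (x * z) = p := by
    have : Fact p.Prime := ⟨hp⟩
    refine orderOf_eq_prime ?_ fun h => ?_
    · rw [Commute.mul_pow (Subgroup.mem_center_iff.1 hzc x), ← hx, pow_orderOf_eq_one, hx, ← hz,
        pow_orderOf_eq_one, one_mul]
    · rw [eq_inv_of_mul_eq_one_left h] at hcon
      exact hcon (inv_mem (Subgroup.mem_zpowers z))
  refine hcon (hG.le_of_le_sup (Subgroup.zpowers z) (Subgroup.zpowers (x * z)) (Subgroup.zpowers x)
    hB (Subgroup.normal_zpowers_of_mem_center (mul_mem hxc hzc))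
    (Subgroup.normal_zpowers_of_mem_center hxc) ?_ ?_ (Subgroup.mem_zpowers x))
  · rw [inf_comm]
    refine Subgroup.inf_eq_bot_of_prime_card hp (by rw [Nat.card_zpowers, hx]) fun h => ?_
    have h1 := mem_zpowers_symm_of_orderOf_eq_prime hp hx hxzp (h (Subgroup.mem_zpowers x))
    have h2 : z ∈ Subgroup.zpowers x := by
      simpa using mul_mem (inv_mem (Subgroup.mem_zpowers x)) h1
    exact hcon (mem_zpowers_symm_of_orderOf_eq_prime hp hz hx h2)
  · rw [Subgroup.zpowers_le]
    have h1 : z⁻¹ ∈ Subgroup.zpowers z ⊔ Subgroup.zpowers (x * z) :=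
      inv_mem (Subgroup.mem_sup_left (Subgroup.mem_zpowers z))
    have h2 : x * z ∈ Subgroup.zpowers z ⊔ Subgroup.zpowers (x * z) :=
      Subgroup.mem_sup_right (Subgroup.mem_zpowers (x * z))
    simpa using mul_mem h2 h1

theorem IsPGroup.exists_pow_notMem_pow_mem {G : Type u} [Group G] {p : ℕ} (hG : IsPGroup p G)
    {C : Subgroup G} {y : G} (hy : y ∉ C) :
    ∃ j : ℕ, y ^ p ^ j ∉ C ∧ (y ^ p ^ j) ^ p ∈ C := by
  classical
  have hex : ∃ j : ℕ, y ^ p ^ j ∈ C := by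
    obtain ⟨k, hk⟩ := hG y
    exact ⟨k, hk ▸ one_mem C⟩
  obtain ⟨j, hj⟩ : ∃ j, Nat.find hex = j + 1 := by
    refine Nat.exists_eq_succ_of_ne_zero fun h => hy ?_
    simpa [h] using Nat.find_spec hex
  refine ⟨j, Nat.find_min hex (by omega), ?_⟩
  rw [← pow_mul, ← pow_succ, ← hj]
  exact Nat.find_spec hex

theorem IsPGroup.isCyclic_of_forall_pow_eq_one {A : Type u} [CommGroup A] [Finite A] {p : ℕ}
    (hp : p.Prime) (hA : IsPGroup p A) {z : A} (hz : orderOf z = p)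
    (h : ∀ x : A, x ^ p = 1 → x ∈ Subgroup.zpowers z) : IsCyclic A := by
  have : Fact p.Prime := ⟨hp⟩
  obtain ⟨a, ha⟩ := Monoid.exists_orderOf_eq_exponent (G := A) Monoid.ExponentExists.of_finite
  obtain ⟨n, hn⟩ := IsPGroup.iff_orderOf.1 hA a
  have hn0 : n ≠ 0 := by
    rintro rfl
    rw [hn] at ha
    have := Monoid.order_dvd_exponent z
    rw [← ha, hz, pow_zero, Nat.dvd_one] at this
    exact hp.one_lt.ne' this
  have hza : z ∈ Subgroup.zpowers a := by
    have h1 : orderOf (a ^ p ^ (n - 1)) = p := by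
      rw [orderOf_pow_of_dvd (pow_ne_zero _ hp.ne_zero) (hn ▸ pow_dvd_pow p (Nat.sub_le n 1)), hn]
      obtain ⟨m, rfl⟩ := Nat.exists_eq_succ_of_ne_zero hn0
      rw [Nat.succ_sub_one, pow_succ, Nat.mul_div_cancel_left _ (pow_pos hp.pos m)]
    have h2 := h (a ^ p ^ (n - 1)) (orderOf_dvd_iff_pow_eq_one.1 (dvd_of_eq h1))
    exact Subgroup.zpowers_le.2 (Subgroup.npow_mem_zpowers a _)
      (mem_zpowers_symm_of_orderOf_eq_prime hp h1 hz h2)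
  refine ⟨⟨a, fun b => ?_⟩⟩
  change b ∈ Subgroup.zpowers a
  by_contra hb
  obtain ⟨j, hj1, hj2⟩ := hA.exists_pow_notMem_pow_mem hb
  set c := b ^ p ^ j
  obtain ⟨i, hi⟩ := hj2
  change a ^ i = c ^ p at hi
  by_cases hpi : (p : ℤ) ∣ i
  · obtain ⟨k, rfl⟩ := hpi
    have h1 : (c * (a ^ k)⁻¹) ^ p = 1 := by
      rw [mul_pow, ← hi, inv_pow, ← zpow_natCast (a ^ k), ← zpow_mul, mul_comm k, mul_inv_cancel]
    have h2 := mul_mem (Subgroup.zpowers_le.2 hza (h _ h1)) (Subgroup.zpow_mem_zpowers a k)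
    rw [inv_mul_cancel_right] at h2
    exact hj1 h2
  · -- The order of `c` would be `p` times that of `a`, which is the exponent.
    have hcop : IsCoprime ((p ^ n : ℕ) : ℤ) i := by
      push_cast
      exact IsCoprime.pow_left ((Nat.prime_iff_prime_int.1 hp).coprime_iff_not_dvd.2 hpi)
    obtain ⟨r, s, hrs⟩ := hcop
    have h1 : c ^ (p ^ n) = 1 := by
      rw [← hn, ha]; exact Monoid.pow_exponent_eq_one c
    have h2 : a = (c ^ p) ^ s := by
      rw [← hi, ← zpow_mul]
      conv_lhs => rw [← zpow_one a, ← hrs, zpow_add, mul_comm r, zpow_mul, zpow_natCast, ← hn,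
        pow_orderOf_eq_one, one_zpow, one_mul, mul_comm s]
    have h3 : a ^ p ^ (n - 1) = 1 := by
      obtain ⟨m, rfl⟩ := Nat.exists_eq_succ_of_ne_zero hn0
      rw [h2, ← zpow_natCast, ← zpow_mul, mul_comm s, zpow_mul, zpow_natCast, ← pow_mul,
        Nat.succ_sub_one, ← pow_succ', h1, one_zpow]
    have h4 := orderOf_dvd_of_pow_eq_one h3
    rw [hn, Nat.pow_dvd_pow_iff_le_right hp.one_lt] at h4
    omega

theorem IsRigid.isCyclic_of_normal {P : Type u} [Group P] [Finite P] {p : ℕ} [Fact p.Prime]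
    (hP : IsPGroup p P) (hR : IsRigid P) {C : Subgroup P} (hC : C.Normal)
    (hcomm : ∀ x ∈ C, ∀ y ∈ C, x * y = y * x) : IsCyclic C := by
  have hp : p.Prime := Fact.out
  have := hP.isNilpotent
  by_cases hbot : C ≤ ⊥
  · rw [le_bot_iff] at hbot
    subst hbot
    infer_instance
  obtain ⟨x₀, hx₀C, hx₀1, hx₀⟩ := Subgroup.exists_mem_forall_commutator_mem hC hbot
  obtain ⟨j, hj1, hj2⟩ := hP.exists_pow_notMem_pow_mem hx₀1
  set z := x₀ ^ p ^ j
  rw [Subgroup.mem_bot] at hj1 hj2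
  have hzp : orderOf z = p := orderOf_eq_prime hj2 hj1
  have hzC : z ∈ C := pow_mem hx₀C _
  have hzc : z ∈ Subgroup.center P := by
    refine pow_mem (Subgroup.mem_center_iff.2 fun g => ?_) _
    have := hx₀ g
    rw [Subgroup.mem_bot, commutatorElement_eq_one_iff_mul_comm] at this
    exact this.symm
  have hz := Subgroup.normal_zpowers_of_mem_center hzc
  -- The elements of `C` of order dividing `p`.
  let V : Subgroup P :=
    { carrier := {x | x ∈ C ∧ x ^ p = 1}
      one_mem' := ⟨one_mem C, one_pow p⟩
      mul_mem' := fun {x y} hx hy => ⟨mul_mem hx.1 hy.1, by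
        rw [Commute.mul_pow (hcomm x hx.1 y hy.1), hx.2, hy.2, one_mul]⟩
      inv_mem' := fun {x} hx => ⟨inv_mem hx.1, by rw [inv_pow, hx.2, inv_one]⟩ }
  have hV : V.Normal := ⟨fun x hx g => ⟨hC.conj_mem x hx.1 g, by rw [conj_pow, hx.2]; simp⟩⟩
  have hVz : V ≤ Subgroup.zpowers z := by
    by_contra hnot
    obtain ⟨x, hxV, hxz, hx⟩ := Subgroup.exists_mem_forall_commutator_mem hV hnot
    have hx1 : x ≠ 1 := fun h => hxz (h ▸ one_mem _)
    exact hxz (hR.mem_zpowers hp (orderOf_eq_prime hxV.2 hx1) hzp hzc hx)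
  let _ : CommGroup C :=
    { (inferInstance : Group C) with mul_comm := fun x y => Subtype.ext (hcomm x x.2 y y.2) }
  refine IsPGroup.isCyclic_of_forall_pow_eq_one hp (hP.to_subgroup C) (z := (⟨z, hzC⟩ : C))
    (by rw [← hzp, ← Subgroup.orderOf_coe]) fun x hx => ?_
  obtain ⟨i, hi⟩ := hVz (show (x : P) ∈ V from ⟨x.2, congrArg Subtype.val hx⟩)
  exact ⟨i, Subtype.ext hi⟩

/-! ### Extending a cyclic group by an element of prime order -/

theorem conj_zpow_of_conj_eq {G : Type u} [Group G] {a x : G} {t : ℤ} (h : x * a * x⁻¹ = a ^ t)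
    (i : ℤ) : x * a ^ i * x⁻¹ = a ^ (t * i) := by
  rw [← conj_zpow, h, zpow_mul]

theorem pow_conj_eq_zpow_pow {G : Type u} [Group G] {a x : G} {t : ℤ} (h : x * a * x⁻¹ = a ^ t)
    (k : ℕ) : x ^ k * a * (x ^ k)⁻¹ = a ^ (t ^ k) := by
  induction k with
  | zero => simp
  | succ k ih =>
    have : x ^ (k + 1) * a * (x ^ (k + 1))⁻¹ = x * (x ^ k * a * (x ^ k)⁻¹) * x⁻¹ := by
      rw [pow_succ']; group
    rw [this, ih, conj_zpow_of_conj_eq h, pow_succ']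

theorem zpow_mul_pow_of_conj_eq {G : Type u} [Group G] {a x : G} {t : ℤ} (h : x * a * x⁻¹ = a ^ t)
    (i : ℤ) (k : ℕ) : (a ^ i * x) ^ k = a ^ (i * ∑ l ∈ Finset.range k, t ^ l) * x ^ k := by
  induction k with
  | zero => simp
  | succ k ih =>
    have h1 : x * a ^ (i * ∑ l ∈ Finset.range k, t ^ l) =
        a ^ (t * (i * ∑ l ∈ Finset.range k, t ^ l)) * x := by
      rw [← conj_zpow_of_conj_eq h, inv_mul_cancel_right]
    rw [pow_succ', ih, mul_assoc, ← mul_assoc x, h1, mul_assoc _ x, ← pow_succ', ← mul_assoc,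
      ← zpow_add]
    congr 2
    rw [Finset.sum_range_succ', Finset.mul_sum, mul_add, Finset.mul_sum, Finset.mul_sum]
    simp only [pow_succ', pow_zero, mul_one]
    rw [add_comm]
    congr 1
    exact Finset.sum_congr rfl fun l _ => by ring

theorem exists_dvd_mul_add_of_not_dvd {p : ℕ} (hp : p.Prime) {n : ℕ} {u : ℤ} (hu : ¬ (p : ℤ) ∣ u)
    (j : ℤ) : ∃ i : ℤ, (p : ℤ) ^ n ∣ i * (p * u) + p * j := by
  have h : IsCoprime ((p : ℤ) ^ n) u :=
    IsCoprime.pow_left ((Nat.prime_iff_prime_int.1 hp).coprime_iff_not_dvd.2 hu)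
  obtain ⟨r, s, hrs⟩ := h
  exact ⟨-j * s, p * j * r, by linear_combination -(p : ℤ) * j * hrs⟩

/-- The computation of the second cohomology of a group of order `p` acting faithfully on `ℤ/pⁿ` via
multiplication by `t`: an invariant class `j` is a norm `-i * ∑ t ^ l`, except when `p = 2` and
`t = -1`. -/
theorem exists_dvd_mul_geom_sum_add {p n : ℕ} (hp : p.Prime) {t j : ℤ}
    (h1 : (p : ℤ) ^ n ∣ t ^ p - 1) (h2 : ¬ (p : ℤ) ^ n ∣ t - 1) (h3 : (p : ℤ) ^ n ∣ j * (t - 1)) :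
    (∃ i : ℤ, (p : ℤ) ^ n ∣ i * (∑ l ∈ Finset.range p, t ^ l) + j) ∨
      (p = 2 ∧ (p : ℤ) ^ n ∣ t + 1) := by
  have hpp : Prime (p : ℤ) := Nat.prime_iff_prime_int.1 hp
  have hn : n ≠ 0 := by
    rintro rfl
    exact h2 (by simp)
  have hpt : (p : ℤ) ∣ t - 1 := by
    have : Fact p.Prime := ⟨hp⟩
    have h4 : (p : ℤ) ∣ t ^ p - 1 := (dvd_pow_self _ hn).trans h1
    rw [← ZMod.intCast_zmod_eq_zero_iff_dvd] at h4 ⊢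
    push_cast at h4 ⊢
    rwa [ZMod.pow_card] at h4
  obtain ⟨s, hs⟩ := hpt
  have hts : t = 1 + p * s := by linear_combination hs
  have hpj : (p : ℤ) ∣ j := by
    by_contra hj
    exact h2 (IsCoprime.dvd_of_dvd_mul_left
      (IsCoprime.pow_left (hpp.coprime_iff_not_dvd.2 hj)) h3)
  obtain ⟨j', rfl⟩ := hpj
  rcases hp.eq_two_or_odd' with rfl | hodd
  · have hS : ∑ l ∈ Finset.range 2, t ^ l = 1 + t := by simp [Finset.sum_range_succ]
    rw [hS]
    push_cast at *
    rcases Int.even_or_odd s with he | ho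
    -- Here `1 + t = 2 * (1 + s)` has exactly one factor `2`.
    · left
      have hu : ¬ (2 : ℤ) ∣ 1 + s := by
        obtain ⟨r, rfl⟩ := he
        omega
      obtain ⟨i, hi⟩ := exists_dvd_mul_add_of_not_dvd Nat.prime_two (n := n) hu j'
      refine ⟨i, ?_⟩
      push_cast at hi
      convert hi using 2
      rw [hts]; ring
    -- Here both `1 + t` and `j` vanish modulo `2 ^ (n - 1)`.
    · obtain ⟨m, rfl⟩ := Nat.exists_eq_succ_of_ne_zero hn
      have hs2 : ¬ (2 : ℤ) ∣ s := by
        obtain ⟨r, rfl⟩ := ho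
        omega
      have hcop : IsCoprime ((2 : ℤ) ^ m) s :=
        IsCoprime.pow_left (Int.prime_two.coprime_iff_not_dvd.2 hs2)
      have key : ∀ y : ℤ, (2 : ℤ) ^ (m + 1) ∣ 2 * y * s → (2 : ℤ) ^ m ∣ y := fun y hy => by
        rw [pow_succ', mul_assoc] at hy
        exact hcop.dvd_of_dvd_mul_right (Int.dvd_of_mul_dvd_mul_left (by norm_num) hy)
      obtain ⟨σ, hσ⟩ := key (1 + t) (by convert h1 using 1; rw [hts]; ring)
      obtain ⟨κ, hκ⟩ := key (2 * j') (by convert h3 using 1; rw [hts]; ring)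
      rw [hσ, hκ, add_comm t, hσ, pow_succ]
      rcases Int.even_or_odd σ with ⟨a, ha⟩ | ⟨a, ha⟩
      · exact Or.inr ⟨trivial, a, by rw [ha]; ring⟩
      · left
        rcases Int.even_or_odd κ with ⟨b, hb⟩ | ⟨b, hb⟩
        · exact ⟨0, b, by rw [hb]; ring⟩
        · exact ⟨1, a + b + 1, by rw [ha, hb]; ring⟩
  -- For odd `p` the sum is congruent to `p` modulo `p ^ 2`, so it has exactly one factor `p`.
  · left
    have h5 := odd_sq_dvd_geom_sum₂_sub (R := ℤ) (a := 1) (b := s) hodd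
    obtain ⟨w, hw⟩ := h5
    simp only [one_pow, mul_one] at hw
    rw [← hts] at hw
    have hu : ¬ (p : ℤ) ∣ 1 + p * w := fun h =>
      hpp.not_dvd_one ((Int.dvd_add_left (Dvd.intro w rfl)).1 h)
    obtain ⟨i, hi⟩ := exists_dvd_mul_add_of_not_dvd hp (n := n) hu j'
    refine ⟨i, ?_⟩
    convert hi using 3
    linear_combination hw

/-- Let `x` normalize but not centralize the cyclic `p`-group `⟨a⟩`, with `x ^ p ∈ ⟨a⟩`. Then the
coset `⟨a⟩ x` contains an element of order dividing `p`, unless `p = 2` and `x` inverts `a`. -/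
theorem exists_zpow_mul_pow_eq_one_or {G : Type u} [Group G] {p n : ℕ} (hp : p.Prime) {a x : G}
    (ha : orderOf a = p ^ n) (hxa : x * a * x⁻¹ ∈ Subgroup.zpowers a)
    (hxp : x ^ p ∈ Subgroup.zpowers a) (hne : x * a ≠ a * x) :
    (∃ i : ℤ, (a ^ i * x) ^ p = 1) ∨ (p = 2 ∧ x * a * x⁻¹ = a⁻¹) := by
  obtain ⟨t, ht⟩ := hxa
  obtain ⟨j, hj⟩ := hxp
  replace ht : x * a * x⁻¹ = a ^ t := ht.symm
  replace hj : a ^ j = x ^ p := hj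
  have hzero : ∀ i : ℤ, a ^ i = 1 ↔ (p : ℤ) ^ n ∣ i := fun i => by
    rw [← orderOf_dvd_iff_zpow_eq_one, ha]; push_cast; rfl
  have hz1 : ∀ i : ℤ, a ^ i = a ↔ (p : ℤ) ^ n ∣ i - 1 := fun i => by
    rw [← hzero, zpow_sub_one, mul_inv_eq_one]
  have h1 : (p : ℤ) ^ n ∣ t ^ p - 1 := by
    have h := pow_conj_eq_zpow_pow ht p
    rw [← hj, (Commute.zpow_self a j).eq, mul_inv_cancel_right] at h
    exact (hz1 _).1 h.symm
  have h2 : ¬ (p : ℤ) ^ n ∣ t - 1 := by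
    rw [← hz1, ← ht]
    exact fun h => hne (mul_inv_eq_iff_eq_mul.1 h)
  have h3 : (p : ℤ) ^ n ∣ j * (t - 1) := by
    have h := conj_zpow_of_conj_eq ht j
    rw [hj, ← pow_succ', pow_succ, mul_inv_cancel_right, ← hj] at h
    rw [← hzero, mul_sub_one, zpow_sub, mul_comm, ← h, mul_inv_cancel]
  rcases exists_dvd_mul_geom_sum_add hp h1 h2 h3 with ⟨i, hi⟩ | ⟨rfl, h⟩
  · left
    refine ⟨i, ?_⟩
    rw [zpow_mul_pow_of_conj_eq ht, ← hj, ← zpow_add, hzero]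
    exact hi
  · right
    refine ⟨rfl, ?_⟩
    rw [ht, eq_inv_iff_mul_eq_one, ← zpow_add_one, hzero]
    exact h

/-! ### Recognizing generalized quaternion groups -/

theorem nonempty_mulEquiv_quaternionGroup {G : Type u} [Group G] {m : ℕ} [NeZero m] {a x : G}
    (ha : orderOf a = 2 * m) (hxa : x * a * x⁻¹ = a⁻¹) (hx2 : x ^ 2 = a ^ m)
    (hx : x ∉ Subgroup.zpowers a)
    (hG : ∀ y : G, y ∈ Subgroup.zpowers a ∨ x⁻¹ * y ∈ Subgroup.zpowers a) :
    Nonempty (G ≃* QuaternionGroup m) := by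
  -- The exponential `ZMod (2 * m) → ⟨a⟩`, in additive notation.
  let φ : ZMod (2 * m) →+ Additive G := ZMod.lift (2 * m)
    ⟨zmultiplesHom (Additive G) (Additive.ofMul a), by
      have : a ^ (2 * m) = 1 := by rw [← ha, pow_orderOf_eq_one]
      change Additive.ofMul (a ^ ((2 * m : ℕ) : ℤ)) = 0
      rw [zpow_natCast, this]
      rfl⟩
  let e : ZMod (2 * m) → G := fun i => (φ i).toMul
  have he_int : ∀ i : ℤ, e i = a ^ i := fun i => by
    change (φ (i : ZMod (2 * m))).toMul = _
    rw [ZMod.lift_coe]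
    rfl
  have he_add : ∀ i j, e (i + j) = e i * e j := fun i j => by
    change (φ (i + j)).toMul = _
    rw [map_add]
    rfl
  have he_neg : ∀ i, e (-i) = (e i)⁻¹ := fun i => by
    change (φ (-i)).toMul = _
    rw [map_neg]
    rfl
  have he_mem : ∀ i, e i ∈ Subgroup.zpowers a := fun i => by
    obtain ⟨k, rfl⟩ := ZMod.intCast_surjective i
    rw [he_int]
    exact Subgroup.zpow_mem_zpowers a k
  have he_x : ∀ i, e i * x = x * e (-i) := fun i => by
    obtain ⟨k, rfl⟩ := ZMod.intCast_surjective i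
    have := conj_zpow_of_conj_eq (t := -1) (by rw [hxa, zpow_neg_one]) (-k)
    rw [mul_inv_eq_iff_eq_mul] at this
    rw [he_neg, he_int, ← zpow_neg, this]
    congr 2
    ring
  have he_inj : Function.Injective e := by
    intro i j hij
    obtain ⟨k, rfl⟩ := ZMod.intCast_surjective i
    obtain ⟨l, rfl⟩ := ZMod.intCast_surjective j
    rw [he_int, he_int, zpow_eq_zpow_iff_modEq, ha] at hij
    exact (ZMod.intCast_eq_intCast_iff _ _ _).2 hij
  have he_m : e m = x ^ 2 := by
    rw [hx2, ← zpow_natCast, ← he_int, Int.cast_natCast]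
  let f : QuaternionGroup m → G := fun q => match q with
    | QuaternionGroup.a i => e i
    | QuaternionGroup.xa i => x * e i
  have hf_mul : ∀ q r, f (q * r) = f q * f r := by
    rintro (i | i) (j | j)
    · rw [QuaternionGroup.a_mul_a]
      exact he_add i j
    · rw [QuaternionGroup.a_mul_xa]
      change x * e (j - i) = e i * (x * e j)
      rw [← mul_assoc, he_x, mul_assoc, ← he_add, sub_eq_neg_add]
    · rw [QuaternionGroup.xa_mul_a]
      change x * e (i + j) = x * e i * e j
      rw [he_add, mul_assoc]
    · rw [QuaternionGroup.xa_mul_xa]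
      change e (m + j - i) = x * e i * (x * e j)
      rw [mul_assoc, ← mul_assoc (e i), he_x, mul_assoc x, ← mul_assoc x x, ← sq, ← he_m, ← he_add,
        ← he_add]
      congr 1
      ring
  let F : QuaternionGroup m →* G := MonoidHom.mk' f hf_mul
  refine ⟨(MulEquiv.ofBijective F ⟨?_, fun y => ?_⟩).symm⟩
  · rw [injective_iff_map_eq_one]
    rintro (i | i) hi
    · have h1 : e i = e ((0 : ℤ) : ZMod (2 * m)) := by
        rw [he_int, zpow_zero]
        exact hi
      rw [he_inj h1, Int.cast_zero, QuaternionGroup.one_def]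
    · have h1 : x * e i = 1 := hi
      exact absurd (eq_inv_of_mul_eq_one_left h1 ▸ inv_mem (he_mem i)) hx
  · rcases hG y with ⟨k, hk⟩ | ⟨k, hk⟩
    · exact ⟨QuaternionGroup.a k, (he_int k).trans hk⟩
    · refine ⟨QuaternionGroup.xa k, ?_⟩
      change x * e k = y
      replace hk : a ^ k = x⁻¹ * y := hk
      rw [he_int, hk, mul_inv_cancel_left]

/-! ### Classification of the rigid groups -/

/-- A nilpotent group has a normal abelian subgroup which contains its own centralizer. -/
theorem exists_normal_comm_self_centralizing (G : Type u) [Group G] [Finite G]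
    [Group.IsNilpotent G] :
    ∃ C : Subgroup G, C.Normal ∧ (∀ x ∈ C, ∀ y ∈ C, x * y = y * x) ∧
      ∀ x, (∀ c ∈ C, c * x = x * c) → x ∈ C := by
  obtain ⟨C, ⟨hC, hcomm⟩, hmax⟩ := Set.Finite.exists_maximal
    (Set.toFinite {C : Subgroup G | C.Normal ∧ ∀ x ∈ C, ∀ y ∈ C, x * y = y * x})
    ⟨⊥, Subgroup.normal_bot, fun x hx y hy => by
      rw [Subgroup.mem_bot.1 hx, Subgroup.mem_bot.1 hy]⟩
  refine ⟨C, hC, hcomm, ?_⟩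
  suffices h : Subgroup.centralizer (C : Set G) ≤ C from
    fun x hx => h (Subgroup.mem_centralizer_iff.2 hx)
  by_contra hnot
  obtain ⟨x, hxZ, hxC, hx⟩ := Subgroup.exists_mem_forall_commutator_mem
    (V := Subgroup.centralizer (C : Set G)) inferInstance hnot
  rw [Subgroup.mem_centralizer_iff] at hxZ
  refine hxC (hmax ⟨Subgroup.normal_zpowers_sup hC hx, ?_⟩ le_sup_right
    (Subgroup.mem_sup_left (Subgroup.mem_zpowers x)))
  intro y hy z hz
  obtain ⟨_, ⟨i, rfl⟩, c, hc, rfl⟩ := Subgroup.mem_sup_of_normal_right.1 hy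
  obtain ⟨_, ⟨j, rfl⟩, d, hd, rfl⟩ := Subgroup.mem_sup_of_normal_right.1 hz
  have hx' : ∀ c ∈ C, ∀ i : ℤ, Commute (x ^ i) c := fun c hc i =>
    (Commute.zpow_right (hxZ c hc) i).symm
  exact ((((Commute.refl x).zpow_zpow i j).mul_left (hx' c hc j).symm).mul_right
    ((hx' d hd i).mul_left (hcomm c hc d hd)))

/-- Automorphisms of a cyclic group commute, so commutators centralize a cyclic normal subgroup. -/
theorem commutator_commute_of_zpowers_normal {G : Type u} [Group G] {a : G}
    (hC : (Subgroup.zpowers a).Normal) (x y : G) : Commute ⁅x, y⁆ a := by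
  have h : ∀ x y : G, x * y * a * (x * y)⁻¹ = y * x * a * (y * x)⁻¹ := fun x y => by
    obtain ⟨s, hs⟩ := hC.conj_mem a (Subgroup.mem_zpowers a) x
    obtain ⟨t, ht⟩ := hC.conj_mem a (Subgroup.mem_zpowers a) y
    replace hs : x * a * x⁻¹ = a ^ s := hs.symm
    replace ht : y * a * y⁻¹ = a ^ t := ht.symm
    have e1 : x * y * a * (x * y)⁻¹ = a ^ (s * t) := by
      rw [← conj_zpow_of_conj_eq hs, ← ht]; group
    have e2 : y * x * a * (y * x)⁻¹ = a ^ (t * s) := by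
      rw [← conj_zpow_of_conj_eq ht, ← hs]; group
    rw [e1, e2, mul_comm]
  have h1 : ⁅x, y⁆ * a * ⁅x, y⁆⁻¹ = a := by
    have e1 : ⁅x, y⁆ * a * ⁅x, y⁆⁻¹ =
        x * y * (x⁻¹ * y⁻¹ * a * (x⁻¹ * y⁻¹)⁻¹) * (x * y)⁻¹ := by
      rw [commutatorElement_def]; group
    rw [e1, h]
    group
  exact mul_inv_eq_iff_eq_mul.1 h1

/-- A cyclic self-centralizing normal subgroup `⟨a⟩` of a rigid `p`-group has no complement in any
subgroup `⟨a, x⟩` with `x ^ p ∈ ⟨a⟩`, which forces `p = 2` and the inversion action. -/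
theorem IsRigid.conj_eq_inv {P : Type u} [Group P] {p n : ℕ} (hR : IsRigid P) (hp : p.Prime)
    {a x : P} (ha : orderOf a = p ^ n) (hC : (Subgroup.zpowers a).Normal)
    (hcent : ∀ y : P, Commute y a → y ∈ Subgroup.zpowers a) (hx : x ∉ Subgroup.zpowers a)
    (hxp : x ^ p ∈ Subgroup.zpowers a) : p = 2 ∧ x * a * x⁻¹ = a⁻¹ ∧ x ^ p ≠ 1 := by
  have hno : ∀ i : ℤ, (a ^ i * x) ^ p ≠ 1 := fun i hi => by
    have hy : a ^ i * x ∉ Subgroup.zpowers a := fun h =>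
      hx ((Subgroup.mul_mem_cancel_left _ (Subgroup.zpow_mem_zpowers a i)).1 h)
    set y := a ^ i * x
    have : Fact p.Prime := ⟨hp⟩
    have hyp : orderOf y = p := orderOf_eq_prime hi fun h => hy (h ▸ one_mem _)
    have hdisj : Subgroup.zpowers y ⊓ Subgroup.zpowers a = ⊥ :=
      Subgroup.inf_eq_bot_of_prime_card hp (by rw [Nat.card_zpowers, hyp])
        fun h => hy (h (Subgroup.mem_zpowers y))
    have hA := hR.normal_of_le_sup _ _ _ hC (Subgroup.normal_zpowers_sup hC fun g =>
      hcent _ (commutator_commute_of_zpowers_normal hC y g)) hdisj le_sup_left le_rfl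
    exact hy (hcent y (Subgroup.commute_of_normal_of_disjoint _ _ hA hC (disjoint_iff.2 hdisj) _ _
      (Subgroup.mem_zpowers y) (Subgroup.mem_zpowers a)))
  rcases exists_zpow_mul_pow_eq_one_or hp ha (hC.conj_mem a (Subgroup.mem_zpowers a) x) hxp
    (fun h => hx (hcent x h)) with ⟨i, hi⟩ | ⟨h2, hinv⟩
  · exact absurd hi (hno i)
  · refine ⟨h2, hinv, fun h => hno 0 ?_⟩
    rwa [zpow_zero, one_mul]

theorem IsRigid.isCyclic_or_quaternionGroup {P : Type u} [Group P] [Finite P] {p : ℕ}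
    [Fact p.Prime] (hP : IsPGroup p P) (hR : IsRigid P) :
    IsCyclic P ∨ p = 2 ∧ ∃ k, 1 ≤ k ∧ Nonempty (P ≃* QuaternionGroup (2 ^ k)) := by
  have hp : p.Prime := Fact.out
  have := hP.isNilpotent
  obtain ⟨C, hC, hcomm, hcent⟩ := exists_normal_comm_self_centralizing P
  obtain ⟨a, rfl⟩ := C.isCyclic_iff_exists_zpowers_eq_top.1
    (hR.isCyclic_of_normal hP hC hcomm)
  replace hcent : ∀ y : P, Commute y a → y ∈ Subgroup.zpowers a := fun y hy =>
    hcent y fun c hc => by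
      obtain ⟨i, rfl⟩ := hc
      exact (hy.zpow_right i).symm
  obtain ⟨n, hn⟩ := IsPGroup.iff_orderOf.1 hP a
  by_cases htop : ∀ x : P, x ∈ Subgroup.zpowers a
  · exact Or.inl ⟨⟨a, htop⟩⟩
  right
  push Not at htop
  obtain ⟨x', hx'⟩ := htop
  obtain ⟨j, hx, hxp⟩ := hP.exists_pow_notMem_pow_mem hx'
  set x := x' ^ p ^ j
  obtain ⟨rfl, hxa, hx2⟩ := hR.conj_eq_inv hp hn hC hcent hx hxp
  refine ⟨rfl, ?_⟩
  have ha2 : a ^ 2 ≠ 1 := fun h => by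
    refine hx (hcent x ?_)
    have : a⁻¹ = a := inv_eq_of_mul_eq_one_left (by rwa [← sq])
    rw [this] at hxa
    exact mul_inv_eq_iff_eq_mul.1 hxa
  -- No automorphism of `⟨a⟩` squares to the inversion, as `4` divides the order of `a`.
  have h4 : ∀ w : P, w ^ 2 * a * (w ^ 2)⁻¹ ≠ a⁻¹ := fun w hw => by
    obtain ⟨s, hs⟩ := hC.conj_mem a (Subgroup.mem_zpowers a) w
    replace hs : w * a * w⁻¹ = a ^ s := hs.symm
    rw [pow_conj_eq_zpow_pow hs, eq_inv_iff_mul_eq_one, ← zpow_add_one,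
      ← orderOf_dvd_iff_zpow_eq_one, hn] at hw
    have hn2 : 2 ≤ n := by
      by_contra hlt
      refine ha2 (orderOf_dvd_iff_pow_eq_one.1 ?_)
      rw [hn]
      exact pow_dvd_pow 2 (by omega : n ≤ 1)
    have h5 : (4 : ℤ) ∣ s ^ 2 + 1 := by
      refine dvd_trans ?_ hw
      exact_mod_cast (pow_dvd_pow 2 hn2 : 2 ^ 2 ∣ 2 ^ n)
    rcases Int.even_or_odd s with ⟨b, rfl⟩ | ⟨b, rfl⟩
    · ring_nf at h5; omega
    · ring_nf at h5; omega
  have hsq : ∀ y : P, y ∉ Subgroup.zpowers a → y ^ 2 ∈ Subgroup.zpowers a := fun y hy => by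
    obtain ⟨j, hj1, hj2⟩ := hP.exists_pow_notMem_pow_mem hy
    rcases j with _ | j
    · simpa using hj2
    · have h6 := (hR.conj_eq_inv hp hn hC hcent hj1 hj2).2.1
      rw [pow_succ, pow_mul] at h6
      exact absurd h6 (h4 _)
  have hindex : ∀ y : P, y ∈ Subgroup.zpowers a ∨ x⁻¹ * y ∈ Subgroup.zpowers a := fun y => by
    by_cases hy : y ∈ Subgroup.zpowers a
    · exact Or.inl hy
    · right
      have hya := (hR.conj_eq_inv hp hn hC hcent hy (hsq y hy)).2.1
      refine hcent _ ?_
      rw [← hxa, mul_inv_eq_iff_eq_mul] at hya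
      change x⁻¹ * y * a = a * (x⁻¹ * y)
      rw [mul_assoc, hya]
      group
  have hn0 : n ≠ 0 := by
    rintro rfl
    rw [pow_zero, orderOf_eq_one_iff] at hn
    exact ha2 (by rw [hn, one_pow])
  obtain ⟨k, rfl⟩ := Nat.exists_eq_add_one_of_ne_zero hn0
  have hk : 1 ≤ k := by
    by_contra hlt
    obtain rfl : k = 0 := by omega
    exact ha2 (orderOf_dvd_iff_pow_eq_one.1 (by rw [hn]; norm_num))
  have hxk : x ^ 2 = a ^ 2 ^ k := by
    obtain ⟨i, hi⟩ := hxp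
    replace hi : a ^ i = x ^ 2 := hi
    have h1 := conj_zpow_of_conj_eq (t := -1) (by rw [hxa, zpow_neg_one]) i
    rw [hi, ← pow_succ', pow_succ, mul_inv_cancel_right, ← hi, zpow_eq_zpow_iff_modEq, hn] at h1
    rw [← hi, ← zpow_natCast, zpow_eq_zpow_iff_modEq, hn]
    have h2 : ¬ ((2 ^ (k + 1) : ℕ) : ℤ) ∣ i := fun h =>
      hx2 (by rw [← hi, ← orderOf_dvd_iff_zpow_eq_one, hn]; exact h)
    obtain ⟨c, hc⟩ := h1.dvd
    push_cast at hc h2 ⊢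
    rw [pow_succ] at hc h2
    have hi' : i = 2 ^ k * (-c) := by linarith
    rcases Int.even_or_odd (-c) with ⟨b, hb⟩ | ⟨b, hb⟩
    · exact absurd ⟨b, by rw [hi', hb]; ring⟩ h2
    · refine (Int.modEq_iff_dvd.2 ⟨b, ?_⟩).symm
      rw [hi', hb]; ring
  exact ⟨k, hk, nonempty_mulEquiv_quaternionGroup (by rw [hn, pow_succ']) hxa hxk hx hindex⟩

theorem IsRigid.isCyclic_sylow {G : Type u} [Group G] [Finite G] [Group.IsNilpotent G]
    (hR : IsRigid G) {p : ℕ} [Fact p.Prime] (hp2 : p ≠ 2) (P : Sylow p G) : IsCyclic P := by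
  obtain ⟨K, -, ⟨e⟩⟩ := P.exists_mulEquiv_prod
  exact ((hR.congr e).fst.isCyclic_or_quaternionGroup P.isPGroup').resolve_right
    fun h => hp2 h.1

theorem IsRigid.classification {G : Type u} [Group G] [Finite G] [Group.IsNilpotent G]
    (hR : IsRigid G) :
    IsCyclic G ∨ ∃ m k : ℕ, Odd m ∧ 1 ≤ k ∧
      Nonempty (G ≃* Multiplicative (ZMod m) × QuaternionGroup (2 ^ k)) := by
  have : Fact (Nat.Prime 2) := ⟨Nat.prime_two⟩
  let P : Sylow 2 G := default
  obtain ⟨K, hK, ⟨e⟩⟩ := P.exists_mulEquiv_prod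
  have hKnil : Group.IsNilpotent K := inferInstance
  have hKR : IsRigid K := (hR.congr (e.trans MulEquiv.prodComm)).fst
  have hKcyc : IsCyclic K := by
    have : IsZGroup K := ⟨fun q hq Q => by
      have : Fact q.Prime := ⟨hq⟩
      by_cases hq2 : q = 2
      · subst hq2
        have h1 : Nat.card Q = 1 := by
          obtain ⟨n, hn⟩ := IsPGroup.iff_card.1 Q.isPGroup'
          have h2 := hK.coprime_dvd_left (Subgroup.card_subgroup_dvd_card (Q : Subgroup K))
          rw [hn] at h2 ⊢
          rcases n with _ | n
          · rfl
          · exact absurd (h2.coprime_dvd_left (dvd_pow_self 2 n.succ_ne_zero)) (by decide)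
        have := (Nat.card_eq_one_iff_unique.1 h1).1
        exact isCyclic_of_subsingleton
      · exact hKR.isCyclic_sylow hq2 Q⟩
    infer_instance
  rcases (hR.congr e).fst.isCyclic_or_quaternionGroup P.isPGroup' with hcyc | ⟨-, k, hk, ⟨f⟩⟩
  · left
    have : IsZGroup G := ⟨fun q hq Q => by
      have : Fact q.Prime := ⟨hq⟩
      by_cases hq2 : q = 2
      · subst hq2
        exact isCyclic_of_surjective (Q.equiv P).symm (Q.equiv P).symm.surjective
      · exact hR.isCyclic_sylow hq2 Q⟩
    infer_instance
  · right
    refine ⟨Nat.card K, k, Nat.coprime_two_right.1 hK, hk, ⟨?_⟩⟩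
    exact (e.trans MulEquiv.prodComm).trans (MulEquiv.prodCongr (zmodCyclicMulEquiv hKcyc).symm f)

theorem theoremA (G : Type u) [Group G] [Finite G] [Group.IsSolvable G] :
    (IsTotallyTwoClosed.{u, v} G ↔
      IsCyclic G ∨
        ∃ m k : ℕ, Odd m ∧ 1 ≤ k ∧
          Nonempty (G ≃* Multiplicative (ZMod m) × QuaternionGroup (2 ^ k))) ∧
    (IsTotallyTwoClosed.{u, v} G → Group.IsNilpotent G) := by
  refine ⟨⟨fun h => ?_, ?_⟩, fun h => h.isRigid.isNilpotent⟩
  · have := h.isRigid.isNilpotent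
    exact h.isRigid.classification
  · rintro (h | ⟨m, k, hm, -, ⟨e⟩⟩)
    · exact isTotallyTwoClosed_of_isCyclic G
    · exact (isTotallyTwoClosed_zmod_prod_quaternionGroup hm).congr e.symm
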